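/- **Corollary 4.4.** Let $\alpha_0$ be the unique number in $(0,1)$ such that $$\frac{1}{2\pi}\int_{-\infty}^{+\infty}\left(1+\alpha_0\tau^2\right)^{-\frac{1}{2\alpha_0}}\,d\tau=\frac{1}{\sqrt{\alpha_0}},\qquad \alpha_0\approx 0.7148659168.$$ Let $b_1,\ldots,b_n\in\mathbb{R}^m$ be vectors (the columns of an $m\times n$ matrix $B$) such that $$\sum_{j=1}^n b_j\otimes b_j=I_m\qquad\text{and}\qquad \|b_j\|\le\sqrt{\alpha_0}\quad\text{for } j=1,\ldots,n,$$ where $b\otimes b$ is the $m\times m$ matrix with $(i,k)$-th entry $\beta_i\beta_k$ for $b=(\beta_1,\ldots,\beta_m)$, $I_m$ is the identity matrix and $\|\cdot\|$ is the Euclidean norm. Let $X_1,\ldots,X_n$ be independent standard exponential random variables (density $e^{-t}$ for $t\ge 0$ and $0$ for $t<0$), and let $Y=\sum_{j=1}^n X_j b_j$. Then the random vector $Y$ has a density $p_Y$ with respect to Lebesgue measure on $\mathbb{R}^m$, and $$\|p_Y\|_\infty\le\alpha_0^{-m/2},$$ where $\|\cdot\|_\infty$ denotes the essential supremum norm. 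-/

import Mathlib

open MeasureTheory ProbabilityTheory Set
open scoped ENNReal

namespace ExponentialSum

/-- `F(α) = (1 / 2π) ∫ (1 + α τ²)^(-1/(2α)) dτ`, considered for `0 < α < 1`, where the integral
converges. -/
noncomputable def F (α : ℝ) : ℝ :=
  1 / (2 * Real.pi) * ∫ τ : ℝ, (1 + α * τ ^ 2) ^ (-(1 / (2 * α)))

lemma integrable_kernel {p : ℝ} (hp : 1 / 2 < p) :
    Integrable (fun s : ℝ => (1 + s ^ 2) ^ (-p)) := by
  have h := integrable_rpow_neg_one_add_norm_sq (E := ℝ) (μ := volume) (r := 2 * p)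
    (by simp; linarith)
  refine h.congr (Filter.Eventually.of_forall fun s => ?_)
  simp only [Real.norm_eq_abs, sq_abs]
  congr 1
  ring

lemma continuous_kernel (p : ℝ) : Continuous (fun s : ℝ => (1 + s ^ 2) ^ (-p)) :=
  Continuous.rpow_const (by fun_prop) fun s => Or.inl (by positivity)

lemma integral_kernel_lt {p q : ℝ} (hp : 1 / 2 < p) (hpq : p < q) :
    ∫ s : ℝ, (1 + s ^ 2) ^ (-q) < ∫ s : ℝ, (1 + s ^ 2) ^ (-p) := by
  have hle : ∀ s : ℝ, (1 + s ^ 2) ^ (-q) ≤ (1 + s ^ 2) ^ (-p) := fun s =>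
    Real.rpow_le_rpow_of_exponent_le (by nlinarith [sq_nonneg s]) (by linarith)
  have iq := integrable_kernel (hp.trans hpq)
  have ip := integrable_kernel hp
  refine lt_of_le_of_ne (integral_mono iq ip hle) fun heq => ?_
  have h0 := (integral_eq_iff_of_ae_le iq ip (Filter.Eventually.of_forall hle)).1 heq
  have h1 := congrFun (((continuous_kernel q).ae_eq_iff_eq volume (continuous_kernel p)).1 h0) 1
  have h2 : (1 + (1 : ℝ) ^ 2) ^ (-q) < (1 + (1 : ℝ) ^ 2) ^ (-p) :=
    Real.rpow_lt_rpow_of_exponent_lt (by norm_num) (by linarith)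
  exact h2.ne h1

lemma continuousOn_integral_kernel :
    ContinuousOn (fun p : ℝ => ∫ s : ℝ, (1 + s ^ 2) ^ (-p)) (Icc (11 / 20) 1) := by
  refine continuousOn_of_dominated (bound := fun s : ℝ => (1 + s ^ 2) ^ (-(11 / 20 : ℝ)))
    (fun p _ => (continuous_kernel p).aestronglyMeasurable)
    (fun p hp => Filter.Eventually.of_forall fun s => ?_)
    (integrable_kernel (by norm_num)) (Filter.Eventually.of_forall fun s => ?_)
  · rw [Real.norm_of_nonneg (by positivity)]
    exact Real.rpow_le_rpow_of_exponent_le (by nlinarith [sq_nonneg s]) (by linarith [hp.1])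
  · have : (1 + s ^ 2 : ℝ) ≠ 0 := by positivity
    exact (Continuous.rpow continuous_const continuous_neg fun _ => Or.inl this).continuousOn

lemma two_pi_lt_integral_kernel : 2 * Real.pi < ∫ s : ℝ, (1 + s ^ 2) ^ (-(11 / 20 : ℝ)) := by
  have hi := integrable_kernel (p := 11 / 20) (by norm_num)
  have hlow : ∫ s in Ioi (1 : ℝ), (1 / 2 : ℝ) * s ^ (-(11 / 10) : ℝ) ≤
      ∫ s in Ioi (1 : ℝ), (1 + s ^ 2) ^ (-(11 / 20 : ℝ)) := by
    refine setIntegral_mono_on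
      ((integrableOn_Ioi_rpow_of_lt (by norm_num) one_pos).const_mul _) hi.integrableOn
      measurableSet_Ioi fun s hs => ?_
    have hs1 : (1 : ℝ) < s := hs
    have hs0 : (0 : ℝ) ≤ s := by linarith
    have e1 : s ^ (-(11 / 10) : ℝ) = (s ^ 2) ^ (-(11 / 20 : ℝ)) := by
      rw [← Real.rpow_natCast, ← Real.rpow_mul hs0]; norm_num
    have e2 : (1 / 2 : ℝ) ≤ 2 ^ (-(11 / 20 : ℝ)) := by
      have : (1 / 2 : ℝ) = 2 ^ (-1 : ℝ) := by rw [Real.rpow_neg_one]; norm_num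
      rw [this]
      exact Real.rpow_le_rpow_of_exponent_le (by norm_num) (by norm_num)
    calc (1 / 2 : ℝ) * s ^ (-(11 / 10) : ℝ)
        ≤ 2 ^ (-(11 / 20 : ℝ)) * (s ^ 2) ^ (-(11 / 20 : ℝ)) := by
          rw [e1]; gcongr
      _ = (2 * s ^ 2) ^ (-(11 / 20 : ℝ)) := (Real.mul_rpow (by norm_num) (by positivity)).symm
      _ ≤ (1 + s ^ 2) ^ (-(11 / 20 : ℝ)) :=
          Real.rpow_le_rpow_of_nonpos (by positivity) (by nlinarith) (by norm_num)
  have heven : ∫ s : ℝ, (1 + s ^ 2) ^ (-(11 / 20 : ℝ)) =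
      2 * ∫ s in Ioi (0 : ℝ), (1 + s ^ 2) ^ (-(11 / 20 : ℝ)) := by
    have := integral_comp_abs (f := fun s : ℝ => (1 + s ^ 2) ^ (-(11 / 20 : ℝ)))
    simpa only [sq_abs] using this
  have hsub : ∫ s in Ioi (1 : ℝ), (1 + s ^ 2) ^ (-(11 / 20 : ℝ)) ≤
      ∫ s in Ioi (0 : ℝ), (1 + s ^ 2) ^ (-(11 / 20 : ℝ)) :=
    setIntegral_mono_set hi.integrableOn
      (Filter.Eventually.of_forall fun s => by positivity)
      (Ioi_subset_Ioi zero_le_one).eventuallyLE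
  rw [integral_const_mul, integral_Ioi_rpow_of_lt (by norm_num) one_pos] at hlow
  norm_num at hlow
  rw [heven]
  linarith [Real.pi_lt_four]

lemma F_eq {α : ℝ} (hα : 0 < α) :
    F α = 1 / √α * (1 / (2 * Real.pi) * ∫ s : ℝ, (1 + s ^ 2) ^ (-(1 / (2 * α)))) := by
  have h := Measure.integral_comp_mul_left (fun s : ℝ => (1 + s ^ 2) ^ (-(1 / (2 * α)))) (√α)
  simp only [mul_pow, Real.sq_sqrt hα.le, smul_eq_mul] at h
  rw [F, h, abs_of_pos (by positivity)]
  ring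

lemma F_eq_iff {α : ℝ} (hα : 0 < α) :
    F α = 1 / √α ↔ ∫ s : ℝ, (1 + s ^ 2) ^ (-(1 / (2 * α))) = 2 * Real.pi := by
  have h1 : 0 < √α := Real.sqrt_pos.2 hα
  have hpi := Real.pi_pos
  rw [F_eq hα]
  constructor
  · intro h
    field_simp at h
    linarith
  · intro h
    rw [h]
    field_simp

theorem existsUnique_alphaZero : ∃! α : ℝ, α ∈ Ioo (0 : ℝ) 1 ∧ F α = 1 / √α := by
  have h1 : ∫ s : ℝ, (1 + s ^ 2) ^ (-(1 : ℝ)) ≤ 2 * Real.pi := by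
    simp only [Real.rpow_neg_one, integral_univ_inv_one_add_sq]
    linarith [Real.pi_pos]
  obtain ⟨p, ⟨hp1, hp2⟩, hp⟩ := intermediate_value_Icc' (by norm_num : (11 / 20 : ℝ) ≤ 1)
    continuousOn_integral_kernel ⟨h1, two_pi_lt_integral_kernel.le⟩
  have hp0 : 0 < p := by linarith
  have hα0 : 0 < 1 / (2 * p) := by positivity
  refine ⟨1 / (2 * p), ⟨⟨hα0, ?_⟩, ?_⟩, ?_⟩
  · rw [div_lt_one (by positivity)]; linarith
  · rw [F_eq_iff hα0]
    have : 1 / (2 * (1 / (2 * p))) = p := by field_simp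
    rw [this]; exact hp
  · rintro β ⟨⟨hβ0, hβ1⟩, hβ⟩
    rw [F_eq_iff hβ0] at hβ
    have hq : 1 / 2 < 1 / (2 * β) := by
      rw [div_lt_div_iff₀ (by norm_num) (by positivity)]; linarith
    have hpq : 1 / (2 * β) = p := by
      rcases lt_trichotomy (1 / (2 * β)) p with h | h | h
      · exact absurd (hp.trans hβ.symm) (integral_kernel_lt hq h).ne
      · exact h
      · exact absurd (hβ.trans hp.symm) (integral_kernel_lt (by linarith) h).ne
    rw [← hpq]; field_simp

/-- The constant `α₀ ≈ 0.7148659168`: the unique `α ∈ (0, 1)` with `F(α) = 1 / √α`. -/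
noncomputable def alphaZero : ℝ := existsUnique_alphaZero.choose

end ExponentialSum

/-! The bound comes from the `L¹` norm of the Fourier transform of the law of `Y`, whose modulus at
`ξ` is `∏ (1 + (2π⟪b j, ξ⟫)²)^(-1/2)`. A finite measure whose transform has `L¹` norm at most `C` is
dominated by `C` times Lebesgue measure (`le_smul_volume_of_integral_norm_fourier_le`).

Put `c j = ‖b j‖²` and `u j = b j / ‖b j‖`, so that `∑ c j • u j ⊗ u j` is the identity. Since `c j
≤ α₀`, Bernoulli's inequality bounds each factor by `f(⟪u j, ξ⟫)^(c j)` with one common `f =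
scaledKernel α₀` (`rpow_neg_half_le_scaledKernel_rpow`). The geometric Brascamp–Lieb inequality
(`IsDecomposition.lintegral_prod_rpow_le`) then bounds the integral by `(∫ f)^m = F(α₀)^m =
α₀^(-m/2)`, by the choice of `α₀`.

Brascamp–Lieb is proved by Barthe's transport: `f` is carried to a Gaussian on the line, and the
induced map of `E` is controlled by Ball's determinant inequality and a norm contraction. -/

namespace ExponentialSum

/-! ### Decompositions of the identity and Ball's inequality. -/

section BrascampLieb

variable {ι E : Type*} [Fintype ι] [NormedAddCommGroup E] [InnerProductSpace ℝ E]

/-- The operator `∑ j, l j • (u j ⊗ u j)`. -/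
noncomputable def frameOp (u : ι → E) (l : ι → ℝ) : E →L[ℝ] E :=
  ∑ j, l j • (innerSL ℝ (u j)).smulRight (u j)

lemma frameOp_apply (u : ι → E) (l : ι → ℝ) (x : E) :
    frameOp u l x = ∑ j, (l j * inner ℝ (u j) x) • u j := by
  simp [frameOp, smul_smul]

lemma inner_frameOp_left (u : ι → E) (l : ι → ℝ) (x y : E) :
    inner ℝ (frameOp u l x) y = ∑ j, l j * inner ℝ (u j) x * inner ℝ (u j) y := by
  simp [frameOp_apply, sum_inner, real_inner_smul_left]

lemma isSymmetric_frameOp (u : ι → E) (l : ι → ℝ) :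
    (frameOp u l : E →ₗ[ℝ] E).IsSymmetric := fun x y => by
  rw [real_inner_comm _ x]
  simp only [ContinuousLinearMap.coe_coe, inner_frameOp_left]
  exact Finset.sum_congr rfl fun j _ => by ring

/-- A geometric Brascamp–Lieb datum of rank one: weighted vectors, of norm one whenever their
weight is nonzero, that decompose the identity. -/
structure IsDecomposition (c : ι → ℝ) (u : ι → E) : Prop where
  nonneg : ∀ j, 0 ≤ c j
  mul_norm_sq : ∀ j, c j * ‖u j‖ ^ 2 = c j
  eq_id : frameOp u c = ContinuousLinearMap.id ℝ E

variable {c : ι → ℝ} {u : ι → E}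

lemma IsDecomposition.sum_inner_mul_inner (h : IsDecomposition c u) (x y : E) :
    ∑ j, c j * inner ℝ (u j) x * inner ℝ (u j) y = inner ℝ x y := by
  rw [← inner_frameOp_left, h.eq_id]; rfl

lemma IsDecomposition.sum_inner_sq (h : IsDecomposition c u) (x : E) :
    ∑ j, c j * inner ℝ (u j) x ^ 2 = ‖x‖ ^ 2 := by
  rw [← real_inner_self_eq_norm_sq, ← h.sum_inner_mul_inner]
  exact Finset.sum_congr rfl fun j _ => by ring

/-- Trace of the decomposition of the identity. -/
lemma IsDecomposition.sum_weights [FiniteDimensional ℝ E] (h : IsDecomposition c u) :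
    ∑ j, c j = Module.finrank ℝ E := by
  let e := stdOrthonormalBasis ℝ E
  have h1 : ∀ j, c j = ∑ k, c j * inner ℝ (u j) (e k) ^ 2 := fun j => by
    rw [← Finset.mul_sum, OrthonormalBasis.sum_sq_inner_left, h.mul_norm_sq]
  calc ∑ j, c j = ∑ j, ∑ k, c j * inner ℝ (u j) (e k) ^ 2 := Finset.sum_congr rfl fun j _ => h1 j
    _ = ∑ k, ‖e k‖ ^ 2 := by
      rw [Finset.sum_comm]
      exact Finset.sum_congr rfl fun k _ => h.sum_inner_sq _
    _ = _ := by simp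

/-- Ball's determinant inequality. -/
lemma IsDecomposition.prod_rpow_le_det [FiniteDimensional ℝ E] (h : IsDecomposition c u)
    {l : ι → ℝ} (hl : ∀ j, 0 < l j) :
    ∏ j, l j ^ c j ≤ (frameOp u fun j => c j * l j).det := by
  have hA := isSymmetric_frameOp u fun j => c j * l j
  let e := hA.eigenvectorBasis rfl
  let μ := hA.eigenvalues rfl
  have hμ : ∀ k, μ k = ∑ j, (c j * inner ℝ (u j) (e k) ^ 2) * l j := fun k => by
    have h1 : inner ℝ ((frameOp u fun j => c j * l j) (e k)) (e k) = μ k := by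
      have := hA.apply_eigenvectorBasis rfl k
      simp only [ContinuousLinearMap.coe_coe] at this
      rw [this, real_inner_smul_left, real_inner_self_eq_norm_sq, OrthonormalBasis.norm_eq_one]
      simp [μ]
    rw [← h1, inner_frameOp_left]
    exact Finset.sum_congr rfl fun j _ => by ring
  -- The weights `c j ⟪u j, e k⟫²` sum to `1` over `j` and to `c j` over `k`. The first makes each
  -- eigenvalue a convex combination of the `l j`, so Jensen applies to `log`; the second recovers
  -- the exponents on summing over `k`.
  have hw : ∀ k, ∑ j, c j * inner ℝ (u j) (e k) ^ 2 = 1 := fun k => by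
    rw [h.sum_inner_sq, OrthonormalBasis.norm_eq_one, one_pow]
  have hw0 : ∀ k j, 0 ≤ c j * inner ℝ (u j) (e k) ^ 2 := fun k j =>
    mul_nonneg (h.nonneg j) (sq_nonneg _)
  have hμpos : ∀ k, 0 < μ k := fun k => by
    have := (convex_Ioi (0 : ℝ)).sum_mem (t := Finset.univ) (fun j _ => hw0 k j) (hw k)
      (fun j _ => hl j)
    rw [hμ]; simpa using this
  have hlog : ∀ k, ∑ j, (c j * inner ℝ (u j) (e k) ^ 2) * Real.log (l j) ≤ Real.log (μ k) :=
    fun k => by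
      have := strictConcaveOn_log_Ioi.concaveOn.le_map_sum (t := Finset.univ)
        (fun j _ => hw0 k j) (hw k) (fun j _ => hl j)
      rw [hμ]; simpa using this
  have hdet : (frameOp u fun j => c j * l j).det = ∏ k, μ k := by
    simpa using hA.det_eq_prod_eigenvalues rfl
  rw [hdet, ← Real.log_le_log_iff (Finset.prod_pos fun j _ => Real.rpow_pos_of_pos (hl j) _)
    (Finset.prod_pos fun k _ => hμpos k), Real.log_prod fun j _ => (Real.rpow_pos_of_pos (hl j) _).ne',
    Real.log_prod fun k _ => (hμpos k).ne']
  calc ∑ j, Real.log (l j ^ c j) = ∑ j, ∑ k, (c j * inner ℝ (u j) (e k) ^ 2) * Real.log (l j) := by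
        refine Finset.sum_congr rfl fun j _ => ?_
        rw [← Finset.sum_mul, ← Finset.mul_sum, OrthonormalBasis.sum_sq_inner_left, h.mul_norm_sq,
          Real.log_rpow (hl j)]
    _ = ∑ k, ∑ j, (c j * inner ℝ (u j) (e k) ^ 2) * Real.log (l j) := Finset.sum_comm
    _ ≤ ∑ k, Real.log (μ k) := Finset.sum_le_sum fun k _ => hlog k

end BrascampLieb

/-! ### Monotone transport on the line. -/

section Transport

/-- The distribution function of a finite density on the line. -/
lemma hasDerivAt_integral_Iic {f : ℝ → ℝ} (hf : Continuous f) (hi : Integrable f) (x : ℝ) :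
    HasDerivAt (fun x => ∫ s in Iic x, f s) (f x) x := by
  have h : (fun x => ∫ s in Iic x, f s) = fun x => (∫ s in Iic 0, f s) + ∫ s in (0 : ℝ)..x, f s := by
    funext y
    rw [← intervalIntegral.integral_Iic_sub_Iic hi.integrableOn hi.integrableOn]
    ring
  rw [h]
  exact (intervalIntegral.integral_hasDerivAt_right (hi.intervalIntegrable)
    hf.stronglyMeasurable.stronglyMeasurableAtFilter hf.continuousAt).const_add _

lemma strictMono_integral_Iic {f : ℝ → ℝ} (hf : Continuous f) (hi : Integrable f)
    (h0 : ∀ s, 0 < f s) : StrictMono (fun x => ∫ s in Iic x, f s) :=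
  strictMono_of_deriv_pos fun x => by rw [(hasDerivAt_integral_Iic hf hi x).deriv]; exact h0 x

lemma tendsto_integral_Iic_atTop {f : ℝ → ℝ} (hi : Integrable f) :
    Filter.Tendsto (fun x => ∫ s in Iic x, f s) Filter.atTop (nhds (∫ s, f s)) := by
  have := tendsto_setIntegral_of_monotone (μ := volume) (f := f) (s := fun x : ℝ => Iic x)
    (fun x => measurableSet_Iic) (fun a b hab => Iic_subset_Iic.2 hab) hi.integrableOn
  simpa [iUnion_Iic] using this

lemma tendsto_integral_Iic_atBot {f : ℝ → ℝ} (hi : Integrable f) :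
    Filter.Tendsto (fun x => ∫ s in Iic x, f s) Filter.atBot (nhds 0) := by
  have h1 : ∀ x, ∫ s in Iic x, f s = (∫ s, f s) - ∫ s in Ioi x, f s := fun x => by
    rw [← integral_add_compl (measurableSet_Iic (a := x)) hi, compl_Iic]; ring
  have := tendsto_setIntegral_of_antitone (μ := volume) (f := f) (s := fun x : ℝ => Iic (-x))
    (fun x => measurableSet_Iic) (fun a b hab => Iic_subset_Iic.2 (neg_le_neg hab))
    ⟨0, hi.integrableOn⟩
  have h2 : ⋂ x : ℝ, Iic (-x) = ∅ := by
    ext y; simp only [mem_iInter, mem_Iic, mem_empty_iff_false, iff_false, not_forall, not_le]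
    exact ⟨-y + 1, by linarith⟩
  rw [h2, setIntegral_empty] at this
  have h3 := this.comp Filter.tendsto_neg_atBot_atTop
  simpa [Function.comp_def] using h3

lemma range_integral_Iic {f : ℝ → ℝ} (hf : Continuous f) (hi : Integrable f)
    (h0 : ∀ s, 0 < f s) : range (fun x => ∫ s in Iic x, f s) = Ioo 0 (∫ s, f s) := by
  have hm := strictMono_integral_Iic hf hi h0
  have hT := tendsto_integral_Iic_atTop hi
  have hB := tendsto_integral_Iic_atBot hi
  apply Subset.antisymm
  · rintro _ ⟨x, rfl⟩
    exact ⟨(hm.monotone.le_of_tendsto hB (x - 1)).trans_lt (hm (by linarith)),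
      (hm (by linarith : x < x + 1)).trans_le (hm.monotone.ge_of_tendsto hT (x + 1))⟩
  · rintro y ⟨hy0, hy1⟩
    obtain ⟨a, ha⟩ := (hB.eventually_lt_const hy0).exists
    obtain ⟨b, hb⟩ := (hT.eventually_const_lt hy1).exists
    have hc : Continuous (fun x => ∫ s in Iic x, f s) :=
      continuous_iff_continuousAt.2 fun x => (hasDerivAt_integral_Iic hf hi x).continuousAt
    exact mem_range_of_exists_le_of_exists_ge hc ⟨a, ha.le⟩ ⟨b, hb.le⟩

/-- The increasing transport map between two continuous positive densities of equal mass. -/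
lemma exists_transport {f g : ℝ → ℝ} (hf : Continuous f) (hfi : Integrable f)
    (hf0 : ∀ s, 0 < f s) (hg : Continuous g) (hgi : Integrable g) (hg0 : ∀ s, 0 < g s)
    (hfg : ∫ s, f s = ∫ s, g s) :
    ∃ T T' : ℝ → ℝ, (∀ s, HasDerivAt T (T' s) s) ∧ (∀ s, 0 < T' s) ∧
      ∀ s, f s = T' s * g (T s) := by
  have hFr := range_integral_Iic hf hfi hf0
  have hGr := range_integral_Iic hg hgi hg0
  -- `T` solves `G ∘ T = F` for the two distribution functions; equal masses give them the same
  -- range.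
  have hex : ∀ s, ∃ t, ∫ x in Iic t, g x = ∫ x in Iic s, f x := fun s => by
    have : (∫ x in Iic s, f x) ∈ range (fun t => ∫ x in Iic t, g x) := by
      rw [hGr, ← hfg, ← hFr]; exact mem_range_self s
    exact this
  choose T hT using hex
  have hGm := strictMono_integral_Iic hg hgi hg0
  have hFm := strictMono_integral_Iic hf hfi hf0
  have hTm : StrictMono T := fun a b hab => hGm.lt_iff_lt.1 (by
    simp only [hT]; exact hFm hab)
  have hTs : Function.Surjective T := fun t => by
    have : (∫ x in Iic t, g x) ∈ range (fun s => ∫ x in Iic s, f x) := by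
      rw [hFr, hfg, ← hGr]; exact mem_range_self t
    obtain ⟨s, hs⟩ := this
    exact ⟨s, hGm.injective (by simp only [hT]; exact hs)⟩
  have hTc : Continuous T := hTm.monotone.continuous_of_surjective hTs
  refine ⟨T, fun s => f s / g (T s), fun s => ?_, fun s => div_pos (hf0 s) (hg0 _), fun s =>
    (div_mul_cancel₀ _ (hg0 _).ne').symm⟩
  have hG := hasDerivAt_integral_Iic hg hgi (T s)
  have hF := hasDerivAt_integral_Iic hf hfi s
  have hcomp : (fun s => ∫ x in Iic (T s), g x) = fun s => ∫ x in Iic s, f x := funext hT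
  -- the difference quotient of `T` is the ratio of those of the distribution functions
  rw [hasDerivAt_iff_tendsto_slope] at hF hG ⊢
  have hTt : Filter.Tendsto T (nhdsWithin s {s}ᶜ) (nhdsWithin (T s) {T s}ᶜ) :=
    tendsto_nhdsWithin_iff.2 ⟨hTc.continuousAt.tendsto.mono_left nhdsWithin_le_nhds,
      eventually_nhdsWithin_of_forall fun x hx => hTm.injective.ne hx⟩
  refine (hF.div (hG.comp hTt) (hg0 _).ne').congr' ?_
  filter_upwards [self_mem_nhdsWithin] with x hx
  have h1 : x - s ≠ 0 := sub_ne_zero.2 hx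
  have h2 : T x - T s ≠ 0 := sub_ne_zero.2 (hTm.injective.ne hx)
  have h3 : (∫ y in Iic x, f y) - ∫ y in Iic s, f y ≠ 0 := sub_ne_zero.2 (hFm.injective.ne hx)
  simp only [Pi.div_apply, Function.comp, slope_def_field, hT]
  field_simp

end Transport

/-! ### The geometric Brascamp–Lieb inequality. -/

section BrascampLiebInequality

variable {ι E : Type*} [Fintype ι] [NormedAddCommGroup E] [InnerProductSpace ℝ E]
  {c : ι → ℝ} {u : ι → E}

/-- The vector field `∑ j, c j • T ⟪u j, x⟫ • u j` transported from the line. -/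
noncomputable def frameMap (c : ι → ℝ) (u : ι → E) (T : ℝ → ℝ) (x : E) : E :=
  ∑ j, (c j * T (inner ℝ (u j) x)) • u j

lemma hasFDerivAt_frameMap {T T' : ℝ → ℝ} (hT : ∀ s, HasDerivAt T (T' s) s) (x : E) :
    HasFDerivAt (frameMap c u T) (frameOp u fun j => c j * T' (inner ℝ (u j) x)) x := by
  unfold frameMap
  have h : ∀ j, HasFDerivAt (fun x => (c j * T (inner ℝ (u j) x)) • u j)
      ((c j * T' (inner ℝ (u j) x)) • (innerSL ℝ (u j)).smulRight (u j)) x := fun j => by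
    have h1 : HasFDerivAt (fun x => inner ℝ (u j) x) (innerSL ℝ (u j)) x :=
      (innerSL ℝ (u j)).hasFDerivAt
    have h2 := (((hT (inner ℝ (u j) x)).comp_hasFDerivAt x h1).const_mul (c j)).smul_const (u j)
    refine h2.congr_fderiv ?_
    ext y
    simp [smul_smul, mul_assoc]
  exact HasFDerivAt.fun_sum fun j _ => h j

/-- Strict monotonicity: pairing the difference of the images with `x - y` gives a sum of
nonnegative terms. If it vanishes, `⟪u j, x - y⟫ = 0` wherever `c j ≠ 0`, so `‖x - y‖² = 0`. -/
lemma IsDecomposition.injective_frameMap (h : IsDecomposition c u) {T : ℝ → ℝ}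
    (hT : StrictMono T) : Function.Injective (frameMap c u T) := by
  intro x y hxy
  have h1 : ∑ j, c j * ((T (inner ℝ (u j) x) - T (inner ℝ (u j) y)) * inner ℝ (u j) (x - y)) = 0 := by
    have : inner ℝ (frameMap c u T x - frameMap c u T y) (x - y) = 0 := by
      rw [hxy, sub_self, inner_zero_left]
    rw [← this, frameMap, frameMap, ← Finset.sum_sub_distrib, sum_inner]
    refine Finset.sum_congr rfl fun j _ => ?_
    rw [← sub_smul, real_inner_smul_left]
    ring
  have h2 : ∀ a b : ℝ, a ≠ b → 0 < (T a - T b) * (a - b) := fun a b hab => by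
    rcases lt_or_gt_of_ne hab with hlt | hgt
    · exact mul_pos_of_neg_of_neg (sub_neg.2 (hT hlt)) (sub_neg.2 hlt)
    · exact mul_pos (sub_pos.2 (hT hgt)) (sub_pos.2 hgt)
  have h3 : ∀ a b : ℝ, 0 ≤ (T a - T b) * (a - b) := fun a b => by
    rcases eq_or_ne a b with rfl | hab
    · simp
    · exact (h2 a b hab).le
  rw [Finset.sum_eq_zero_iff_of_nonneg fun j _ =>
    mul_nonneg (h.nonneg j) (by rw [inner_sub_right]; exact h3 _ _)] at h1
  have h4 : ‖x - y‖ ^ 2 = 0 := by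
    rw [← h.sum_inner_sq]
    refine Finset.sum_eq_zero fun j hj => ?_
    rcases mul_eq_zero.1 (h1 j hj) with h5 | h5
    · rw [h5, zero_mul]
    · rw [inner_sub_right] at h5 ⊢
      by_cases h6 : (inner ℝ (u j) x : ℝ) = inner ℝ (u j) y
      · rw [h6, sub_self]; ring
      · exact absurd h5 (h2 _ _ h6).ne'
  exact sub_eq_zero.1 (norm_eq_zero.1 (pow_eq_zero_iff two_ne_zero |>.1 h4))

/-- Expand `∑ c j (T⟪u j, x⟫ - ⟪u j, v⟫)² ≥ 0` with `v` the image of `x`. -/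
lemma IsDecomposition.norm_frameMap_sq_le (h : IsDecomposition c u) (T : ℝ → ℝ) (x : E) :
    ‖frameMap c u T x‖ ^ 2 ≤ ∑ j, c j * T (inner ℝ (u j) x) ^ 2 := by
  set v := frameMap c u T x with hv
  have h1 : ∑ j, c j * T (inner ℝ (u j) x) * inner ℝ (u j) v = ‖v‖ ^ 2 := by
    rw [← real_inner_self_eq_norm_sq]
    nth_rewrite 2 [hv]
    rw [frameMap, sum_inner]
    simp only [real_inner_smul_left]
  have h2 : 0 ≤ ∑ j, c j * (T (inner ℝ (u j) x) - inner ℝ (u j) v) ^ 2 :=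
    Finset.sum_nonneg fun j _ => mul_nonneg (h.nonneg j) (sq_nonneg _)
  have h3 : ∑ j, c j * (T (inner ℝ (u j) x) - inner ℝ (u j) v) ^ 2 =
      ∑ j, c j * T (inner ℝ (u j) x) ^ 2 - 2 * ∑ j, c j * T (inner ℝ (u j) x) * inner ℝ (u j) v +
        ∑ j, c j * inner ℝ (u j) v ^ 2 := by
    rw [Finset.mul_sum, ← Finset.sum_sub_distrib, ← Finset.sum_add_distrib]
    exact Finset.sum_congr rfl fun j _ => by ring
  rw [h3, h1, h.sum_inner_sq] at h2
  linarith

variable [FiniteDimensional ℝ E] [MeasurableSpace E] [BorelSpace E]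

lemma lintegral_exp_neg_pi_mul_norm_sq :
    ∫⁻ x : E, ENNReal.ofReal (Real.exp (-Real.pi * ‖x‖ ^ 2)) = 1 := by
  have h := GaussianFourier.integral_rexp_neg_mul_sq_norm (V := E) Real.pi_pos
  rw [div_self Real.pi_ne_zero, Real.one_rpow] at h
  rw [← ofReal_integral_eq_lintegral_ofReal (.of_integral_ne_zero (by rw [h]; exact one_ne_zero))
    (Filter.Eventually.of_forall fun x => (Real.exp_pos _).le), h, ENNReal.ofReal_one]

/-- The geometric Brascamp–Lieb inequality of rank one, for a single continuous positive
function. -/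
theorem IsDecomposition.lintegral_prod_rpow_le (h : IsDecomposition c u) {f : ℝ → ℝ}
    (hf : Continuous f) (hi : Integrable f) (hf0 : ∀ s, 0 < f s) :
    ∫⁻ x : E, ENNReal.ofReal (∏ j, f (inner ℝ (u j) x) ^ c j) ≤
      ENNReal.ofReal ((∫ s, f s) ^ Module.finrank ℝ E) := by
  set M := ∫ s, f s with hM
  have hM0 : 0 < M := integral_pos_of_integrable_nonneg_nonzero (x := 0) hf hi
    (fun s => (hf0 s).le) (hf0 0).ne'
  have hgi : ∫ s : ℝ, M * Real.exp (-Real.pi * s ^ 2) = M := by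
    rw [integral_const_mul, integral_gaussian, div_self Real.pi_ne_zero, Real.sqrt_one, mul_one]
  -- The target is a Gaussian of the same mass `M`; the factor `π` gives `exp (-π‖x‖²)` integral `1`
  -- in every dimension.
  obtain ⟨T, T', hT, hT0, hfT⟩ := exists_transport hf hi hf0
    (g := fun s => M * Real.exp (-Real.pi * s ^ 2)) (by fun_prop)
    ((integrable_exp_neg_mul_sq Real.pi_pos).const_mul M) (fun s => by positivity) hgi.symm
  have hTm : StrictMono T := strictMono_of_deriv_pos fun x => by rw [(hT x).deriv]; exact hT0 x
  have hpt : ∀ x : E, ∏ j, f (inner ℝ (u j) x) ^ c j ≤ M ^ Module.finrank ℝ E *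
      (|(frameOp u fun j => c j * T' (inner ℝ (u j) x)).det| *
        Real.exp (-Real.pi * ‖frameMap c u T x‖ ^ 2)) := fun x => by
    have e1 : ∏ j, f (inner ℝ (u j) x) ^ c j = M ^ Module.finrank ℝ E *
        ((∏ j, T' (inner ℝ (u j) x) ^ c j) *
          Real.exp (-Real.pi * ∑ j, c j * T (inner ℝ (u j) x) ^ 2)) := by
      have e2 : ∀ j, f (inner ℝ (u j) x) ^ c j = M ^ c j * (T' (inner ℝ (u j) x) ^ c j *
          Real.exp (-Real.pi * (c j * T (inner ℝ (u j) x) ^ 2))) := fun j => by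
        rw [hfT, Real.mul_rpow (hT0 _).le (by positivity), Real.mul_rpow hM0.le (by positivity),
          ← Real.exp_mul]
        ring_nf
      simp only [e2, Finset.prod_mul_distrib]
      rw [← Real.rpow_sum_of_pos hM0, h.sum_weights, Real.rpow_natCast, ← Real.exp_sum,
        Finset.mul_sum]
    rw [e1]
    gcongr ?_ * (?_ * Real.exp ?_)
    · exact (h.prod_rpow_le_det fun j => hT0 _).trans (le_abs_self _)
    · have := h.norm_frameMap_sq_le T x
      nlinarith [Real.pi_pos]
  calc ∫⁻ x : E, ENNReal.ofReal (∏ j, f (inner ℝ (u j) x) ^ c j)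
      ≤ ∫⁻ x : E, ENNReal.ofReal (M ^ Module.finrank ℝ E) *
        (ENNReal.ofReal |(frameOp u fun j => c j * T' (inner ℝ (u j) x)).det| *
          ENNReal.ofReal (Real.exp (-Real.pi * ‖frameMap c u T x‖ ^ 2))) := by
        refine lintegral_mono fun x => (ENNReal.ofReal_le_ofReal (hpt x)).trans_eq ?_
        rw [ENNReal.ofReal_mul (by positivity), ENNReal.ofReal_mul (by positivity)]
    -- Change of variables along `frameMap`. Injectivity suffices: for an upper bound the image may
    -- be enlarged to all of `E`.
    _ = ENNReal.ofReal (M ^ Module.finrank ℝ E) *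
        ∫⁻ y in frameMap c u T '' univ, ENNReal.ofReal (Real.exp (-Real.pi * ‖y‖ ^ 2)) := by
        rw [lintegral_const_mul' _ _ ENNReal.ofReal_ne_top,
          lintegral_image_eq_lintegral_abs_det_fderiv_mul volume MeasurableSet.univ
            (fun x _ => (hasFDerivAt_frameMap hT x).hasFDerivWithinAt)
            (h.injective_frameMap hTm).injOn, setLIntegral_univ]
    _ ≤ ENNReal.ofReal (M ^ Module.finrank ℝ E) * 1 := by
        gcongr
        exact (setLIntegral_le_lintegral _ _).trans_eq lintegral_exp_neg_pi_mul_norm_sq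
    _ = _ := mul_one _

end BrascampLiebInequality

/-! ### Measures with integrable Fourier transform. -/

section BoundedDensity

open scoped FourierTransform SchwartzMap ContDiff Manifold

variable {E : Type*} [NormedAddCommGroup E] [InnerProductSpace ℝ E] [FiniteDimensional ℝ E]

lemma exists_smooth_bump {K U : Set E} (hK : IsCompact K) (hU : IsOpen U) (hKU : K ⊆ U) :
    ∃ g : E → ℝ, ContDiff ℝ ∞ g ∧ HasCompactSupport g ∧ (∀ x, g x ∈ Icc 0 1) ∧
      (∀ x ∈ K, g x = 1) ∧ ∀ x ∉ U, g x = 0 := by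
  obtain ⟨V, hVo, hKV, hVU, hVc⟩ := exists_open_between_and_isCompact_closure hK hU hKU
  obtain ⟨g, hg0, hg1, hg⟩ := exists_contMDiffMap_zero_one_of_isClosed (n := ⊤) 𝓘(ℝ, E)
    hVo.isClosed_compl hK.isClosed (disjoint_compl_left_iff_subset.2 hKV)
  refine ⟨g, g.contMDiff.contDiff, ?_, hg, fun x hx => hg1 hx, fun x hx => hg0 ?_⟩
  · exact HasCompactSupport.of_support_subset_isCompact hVc fun x hx => by
      by_contra h
      exact hx (hg0 fun hxV => h (subset_closure hxV))
  · exact fun hxV => hx (hVU (subset_closure hxV))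

variable [MeasurableSpace E] [BorelSpace E]

/-- A finite measure is bounded on test functions by the `L¹` norm of its Fourier transform. -/
lemma norm_integral_schwartz_le (μ : Measure E) [IsFiniteMeasure μ] {C : ℝ}
    (hφ : Integrable fun ξ : E => VectorFourier.fourierIntegral Real.fourierChar μ (innerₗ E)
      (1 : E → ℂ) ξ)
    (hC : ∫ ξ : E, ‖VectorFourier.fourierIntegral Real.fourierChar μ (innerₗ E) (1 : E → ℂ) ξ‖ ≤ C)
    (h : 𝓢(E, ℂ)) : ‖∫ x, h x ∂μ‖ ≤ C * ∫ x, ‖h x‖ := by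
  set φ : E → ℂ := fun ξ => VectorFourier.fourierIntegral Real.fourierChar μ (innerₗ E)
    (1 : E → ℂ) ξ with hφd
  let k : 𝓢(E, ℂ) := 𝓕⁻ h
  have hk : 𝓕 (k : E → ℂ) = h := by
    rw [← SchwartzMap.fourier_coe]; simp [k]
  have hL : Continuous fun p : E × E => innerₗ E p.1 p.2 := by
    simpa using continuous_inner
  have h1 : ∫ x, h x ∂μ = ∫ ξ, φ ξ * k ξ := by
    have := VectorFourier.integral_fourierIntegral_smul_eq_flip (μ := μ) (ν := volume)
      (L := innerₗ E) (f := (1 : E → ℂ)) (g := (k : E → ℂ)) Real.continuous_fourierChar hL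
      (integrable_const (1 : ℂ)) k.integrable
    simp only [smul_eq_mul, Pi.one_apply, one_mul, flip_innerₗ] at this
    rw [this, ← hk]
    rfl
  -- Self-adjointness again, now for the inverse transform, which is the Fourier integral of the
  -- form `-innerₗ E`.
  have h2 : ∫ ξ, φ ξ * k ξ = ∫ x, 𝓕⁻ φ x * h x := by
    have := VectorFourier.integral_fourierIntegral_smul_eq_flip (μ := volume) (ν := volume)
      (L := -innerₗ E) (f := φ) (g := (h : E → ℂ)) Real.continuous_fourierChar
      (by simpa only [LinearMap.neg_apply] using Continuous.fun_neg hL) hφ h.integrable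
    simp only [smul_eq_mul] at this
    have hf : (-innerₗ E).flip = -innerₗ E := by
      rw [← flip_innerₗ E]; ext; simp [real_inner_comm]
    rw [hf] at this
    rw [SchwartzMap.fourierInv_coe]
    exact this.symm
  have hb : ∀ x, ‖𝓕⁻ φ x‖ ≤ C := fun x =>
    (VectorFourier.norm_fourierIntegral_le_integral_norm _ _ _ _ _).trans hC
  rw [h1, h2, ← integral_const_mul]
  refine norm_integral_le_of_norm_le (h.integrable.norm.const_mul C)
    (Filter.Eventually.of_forall fun x => ?_)
  rw [norm_mul]
  exact mul_le_mul_of_nonneg_right (hb x) (norm_nonneg _)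

/-- Testing against a bump between a compact `K` and an open `U` gives `μ K ≤ C vol U`; outer
regularity of volume and inner regularity of `μ` extend this to measurable sets. -/
theorem le_smul_volume_of_integral_norm_fourier_le (μ : Measure E) [IsFiniteMeasure μ] {C : ℝ}
    (hφ : Integrable fun ξ : E => VectorFourier.fourierIntegral Real.fourierChar μ (innerₗ E)
      (1 : E → ℂ) ξ)
    (hC : ∫ ξ : E, ‖VectorFourier.fourierIntegral Real.fourierChar μ (innerₗ E) (1 : E → ℂ) ξ‖ ≤ C) :
    μ ≤ ENNReal.ofReal C • volume := by
  have hC0 : 0 ≤ C := (integral_nonneg fun _ => norm_nonneg _).trans hC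
  have hKU : ∀ K U : Set E, IsCompact K → IsOpen U → K ⊆ U → μ K ≤ ENNReal.ofReal C * volume U := by
    intro K U hK hU hKU
    obtain ⟨g, hgs, hgc, hg01, hgK, hgU⟩ := exists_smooth_bump hK hU hKU
    have hgi : ∀ ν : Measure E, IsFiniteMeasureOnCompacts ν → Integrable g ν := fun ν _ =>
      hgs.continuous.integrable_of_hasCompactSupport hgc
    have hc : HasCompactSupport (Complex.ofRealCLM ∘ g) := hgc.comp_left rfl
    have h1 := norm_integral_schwartz_le μ hφ hC
      (hc.toSchwartzMap (Complex.ofRealCLM.contDiff.comp hgs))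
    simp only [HasCompactSupport.toSchwartzMap_toFun, Function.comp_apply, Complex.ofRealCLM_apply,
      integral_complex_ofReal, Complex.norm_real] at h1
    have h2 : ∫ x, g x ∂μ ≤ C * ∫ x, g x := by
      refine (le_abs_self _).trans (h1.trans_eq ?_)
      congr 1
      exact integral_congr_ae (Filter.Eventually.of_forall fun x => abs_of_nonneg (hg01 x).1)
    have hnn : ∀ ν : Measure E, 0 ≤ᵐ[ν] g := fun ν => Filter.Eventually.of_forall fun x => (hg01 x).1
    calc μ K = ∫⁻ x, K.indicator 1 x ∂μ := (lintegral_indicator_one hK.measurableSet).symm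
      _ ≤ ∫⁻ x, ENNReal.ofReal (g x) ∂μ := by
        refine lintegral_mono fun x => ?_
        by_cases hx : x ∈ K
        · simp [hx, hgK x hx]
        · simp [hx]
      _ = ENNReal.ofReal (∫ x, g x ∂μ) :=
        (ofReal_integral_eq_lintegral_ofReal (hgi μ inferInstance) (hnn μ)).symm
      _ ≤ ENNReal.ofReal (C * ∫ x, g x) := ENNReal.ofReal_le_ofReal h2
      _ = ENNReal.ofReal C * ∫⁻ x, ENNReal.ofReal (g x) := by
        rw [ENNReal.ofReal_mul hC0,
          ofReal_integral_eq_lintegral_ofReal (hgi volume inferInstance) (hnn volume)]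
      _ ≤ ENNReal.ofReal C * ∫⁻ x, U.indicator 1 x := by
        gcongr with x
        by_cases hx : x ∈ U
        · simpa [hx] using (hg01 x).2
        · simp [hx, hgU x hx]
      _ = ENNReal.ofReal C * volume U := by rw [lintegral_indicator_one hU.measurableSet]
  have hKc : ∀ K : Set E, IsCompact K → μ K ≤ ENNReal.ofReal C * volume K := by
    intro K hK
    have hreg : (ENNReal.ofReal C • (volume : Measure E)).OuterRegular :=
      Measure.OuterRegular.smul _ ENNReal.ofReal_ne_top
    rw [← smul_eq_mul, ← Measure.smul_apply, K.measure_eq_iInf_isOpen (ENNReal.ofReal C • volume)]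
    exact le_iInf₂ fun U hKU' => le_iInf fun hU => hKU K U hK hU hKU'
  refine Measure.le_iff.2 fun s hs => ?_
  rw [hs.measure_eq_iSup_isCompact]
  refine iSup₂_le fun K hKs => iSup_le fun hK => (hKc K hK).trans ?_
  rw [Measure.smul_apply, smul_eq_mul]
  gcongr

end BoundedDensity

/-! ### Characteristic functions of exponential sums. -/

section CharacteristicFunction

lemma charFun_expMeasure_one (t : ℝ) :
    charFun (expMeasure 1) t = 1 / (1 - t * Complex.I) := by
  have hd : ∀ x : ℝ, x ∈ Ioi (0 : ℝ) → ((exponentialPDF 1 x).toReal : ℝ) • Complex.exp (t * x * Complex.I)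
      = Complex.exp ((-1 + t * Complex.I) * x) := fun x hx => by
    rw [exponentialPDF_of_nonneg (le_of_lt hx), ENNReal.toReal_ofReal (by positivity),
      Complex.real_smul, one_mul, one_mul, Complex.ofReal_exp, ← Complex.exp_add]
    congr 1
    push_cast
    ring
  have hz : ∀ x : ℝ, x ∉ Ici (0 : ℝ) → ((exponentialPDF 1 x).toReal : ℝ) •
      Complex.exp (t * x * Complex.I) = 0 := fun x hx => by
    rw [exponentialPDF_of_neg (not_le.1 hx), ENNReal.toReal_zero, zero_smul]
  have hm : Measurable (exponentialPDF 1) := (measurable_exponentialPDFReal 1).ennreal_ofReal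
  have hexp : expMeasure 1 = volume.withDensity (exponentialPDF 1) := rfl
  rw [charFun_apply_real, hexp, integral_withDensity_eq_integral_toReal_smul hm
    (Filter.Eventually.of_forall fun x => ENNReal.ofReal_lt_top),
    ← setIntegral_eq_integral_of_forall_compl_eq_zero hz, integral_Ici_eq_integral_Ioi,
    setIntegral_congr_fun measurableSet_Ioi hd, integral_exp_mul_complex_Ioi (by simp)]
  have h1 : (-1 + t * Complex.I : ℂ) ≠ 0 := fun h => by simpa using congrArg Complex.re h
  have h2 : (1 - t * Complex.I : ℂ) ≠ 0 := fun h => by simpa using congrArg Complex.re h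
  rw [Complex.ofReal_zero, mul_zero, Complex.exp_zero, div_eq_div_iff h1 h2]
  ring

lemma norm_charFun_expMeasure_one (t : ℝ) :
    ‖charFun (expMeasure 1) t‖ = (1 + t ^ 2) ^ (-(1 / 2) : ℝ) := by
  have h : Complex.normSq (1 - t * Complex.I) = 1 + t ^ 2 := by
    rw [Complex.normSq_apply]; simp; ring
  rw [charFun_expMeasure_one, norm_div, norm_one, Complex.norm_def, h,
    Real.rpow_neg (by positivity), Real.sqrt_eq_rpow, one_div]

variable {E : Type*} [NormedAddCommGroup E] [InnerProductSpace ℝ E] [MeasurableSpace E]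
  [BorelSpace E]

lemma charFun_map_smul_const {Ω : Type*} [MeasurableSpace Ω] {P : Measure Ω} {X : Ω → ℝ}
    (hX : AEMeasurable X P) (v t : E) :
    charFun (P.map fun ω => X ω • v) t = charFun (P.map X) (inner ℝ v t) := by
  have h1 : Measurable fun r : ℝ => r • v := (continuous_id.smul continuous_const).measurable
  rw [charFun_apply, charFun_apply_real, integral_map, integral_map hX]
  · refine integral_congr_ae (Filter.Eventually.of_forall fun ω => ?_)
    simp only [real_inner_smul_left]
    push_cast
    ring_nf
  · exact (by fun_prop : Continuous _).aestronglyMeasurable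
  · exact h1.comp_aemeasurable hX
  · exact (by fun_prop : Continuous fun x : E => Complex.exp (inner ℝ x t * Complex.I)).aestronglyMeasurable

lemma norm_charFun_sum_smul [SecondCountableTopology E] [CompleteSpace E] {ι Ω : Type*} [Fintype ι]
    [MeasurableSpace Ω] {P : Measure Ω} [IsProbabilityMeasure P] {X : ι → Ω → ℝ}
    (hX_indep : iIndepFun X P) (hX_law : ∀ j, HasLaw (X j) (expMeasure 1) P) (b : ι → E) (t : E) :
    ‖charFun (P.map fun ω => ∑ j, X j ω • b j) t‖ =
      ∏ j, (1 + inner ℝ (b j) t ^ 2) ^ (-(1 / 2) : ℝ) := by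
  have hm : ∀ j, Measurable fun r : ℝ => r • b j := fun j =>
    (continuous_id.smul continuous_const).measurable
  have hind : iIndepFun (fun j ω => X j ω • b j) P := hX_indep.comp (fun j r => r • b j) hm
  have h : charFun (P.map fun ω => ∑ j, X j ω • b j) = ∏ j, charFun (P.map fun ω => X j ω • b j) :=
    hind.charFun_map_fun_sum_eq_prod fun j => (hm j).comp_aemeasurable (hX_law j).aemeasurable
  rw [h, Finset.prod_apply, norm_prod]
  refine Finset.prod_congr rfl fun j _ => ?_
  rw [charFun_map_smul_const (hX_law j).aemeasurable, (hX_law j).map_eq,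
    norm_charFun_expMeasure_one]

end CharacteristicFunction

/-! ### The kernel attached to `α₀`. -/

section AlphaZero

lemma alphaZero_mem : alphaZero ∈ Ioo (0 : ℝ) 1 := existsUnique_alphaZero.choose_spec.1.1

lemma F_alphaZero : F alphaZero = 1 / √alphaZero := existsUnique_alphaZero.choose_spec.1.2

/-- The integrand of `F α`, on the scale of the Fourier transform. -/
noncomputable def scaledKernel (α s : ℝ) : ℝ :=
  (1 + α * (2 * Real.pi * s) ^ 2) ^ (-(1 / (2 * α)))

lemma scaledKernel_pos {α : ℝ} (hα : 0 < α) (s : ℝ) : 0 < scaledKernel α s := by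
  unfold scaledKernel; positivity

lemma continuous_scaledKernel {α : ℝ} (hα : 0 < α) : Continuous (scaledKernel α) :=
  Continuous.rpow_const (by fun_prop) fun s => Or.inl (by positivity)

lemma integrable_scaledKernel {α : ℝ} (hα : α ∈ Ioo (0 : ℝ) 1) : Integrable (scaledKernel α) := by
  obtain ⟨h0, h1⟩ := hα
  have h2 : 1 / 2 < 1 / (2 * α) := by
    rw [div_lt_div_iff₀ (by norm_num) (by positivity)]; linarith
  have h3 := (integrable_kernel h2).comp_mul_left'
    (mul_pos (Real.sqrt_pos.2 h0) Real.two_pi_pos).ne'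
  refine h3.congr (Filter.Eventually.of_forall fun s => ?_)
  simp only [scaledKernel, mul_pow, Real.sq_sqrt h0.le]
  ring_nf

lemma integral_scaledKernel (α : ℝ) : ∫ s, scaledKernel α s = F α := by
  have h := Measure.integral_comp_mul_left (fun τ : ℝ => (1 + α * τ ^ 2) ^ (-(1 / (2 * α))))
    (2 * Real.pi)
  rw [smul_eq_mul, abs_of_pos (by positivity)] at h
  rw [F, one_div, ← h]
  rfl

/-- `c ↦ (1 + c s²) ^ (-1 / (2 c))` is monotone. -/
lemma rpow_neg_half_le_scaledKernel_rpow {α c : ℝ} (hα : 0 < α) (hc0 : 0 ≤ c) (hc : c ≤ α)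
    (s : ℝ) : (1 + c * (2 * Real.pi * s) ^ 2) ^ (-(1 / 2) : ℝ) ≤ scaledKernel α s ^ c := by
  -- Bernoulli's inequality with exponent `c / α ≤ 1`. Having `c` as an exponent on the right-hand
  -- side of the goal allows `c = 0`, the case of a zero vector.
  have h1 : (1 + α * (2 * Real.pi * s) ^ 2) ^ (c / α) ≤ 1 + c * (2 * Real.pi * s) ^ 2 := by
    have := rpow_one_add_le_one_add_mul_self (s := α * (2 * Real.pi * s) ^ 2) (p := c / α)
      (by have : 0 ≤ α * (2 * Real.pi * s) ^ 2 := by positivity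
          linarith) (by positivity) ((div_le_one hα).2 hc)
    refine this.trans_eq ?_
    field_simp
  have h2 : scaledKernel α s ^ c =
      ((1 + α * (2 * Real.pi * s) ^ 2) ^ (c / α)) ^ (-(1 / 2) : ℝ) := by
    rw [scaledKernel, ← Real.rpow_mul (by positivity), ← Real.rpow_mul (by positivity)]
    congr 1
    field_simp
  rw [h2]
  exact Real.rpow_le_rpow_of_nonpos (by positivity) h1 (by norm_num)

end AlphaZero

/-! ### Domination by Lebesgue measure. -/

section Density

/-- A decomposition of the identity normalizes to a Brascamp–Lieb datum. -/
lemma isDecomposition_normalize {ι E : Type*} [Fintype ι] [NormedAddCommGroup E]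
    [InnerProductSpace ℝ E] {b : ι → E} (hb : ∀ x, ∑ j, (inner ℝ (b j) x : ℝ) • b j = x) :
    IsDecomposition (fun j => ‖b j‖ ^ 2) (fun j => ‖b j‖⁻¹ • b j) where
  nonneg j := sq_nonneg _
  mul_norm_sq j := by
    -- Since `0⁻¹ = 0`, a zero vector stays zero and has weight `0`.
    rcases eq_or_ne (b j) 0 with h | h
    · simp [h]
    · rw [norm_smul, norm_inv, norm_norm, inv_mul_cancel₀ (norm_ne_zero_iff.2 h)]; simp
  eq_id := by
    ext x
    rw [frameOp_apply, ContinuousLinearMap.id_apply]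
    nth_rewrite 2 [← hb x]
    refine Finset.sum_congr rfl fun j _ => ?_
    rcases eq_or_ne (b j) 0 with h | h
    · simp [h]
    · have := norm_ne_zero_iff.2 h
      rw [real_inner_smul_left, smul_smul]
      congr 1
      field_simp

lemma map_sum_smul_le_smul_volume {ι E : Type*} [Fintype ι] [NormedAddCommGroup E]
    [InnerProductSpace ℝ E] [FiniteDimensional ℝ E] [MeasurableSpace E] [BorelSpace E]
    {b : ι → E} (hb : ∀ x, ∑ j, (inner ℝ (b j) x : ℝ) • b j = x)
    (hb_norm : ∀ j, ‖b j‖ ≤ √alphaZero) {Ω : Type*} [MeasurableSpace Ω] {P : Measure Ω}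
    [IsProbabilityMeasure P] {X : ι → Ω → ℝ} (hX_indep : iIndepFun X P)
    (hX_law : ∀ j, HasLaw (X j) (expMeasure 1) P) :
    P.map (fun ω => ∑ j, X j ω • b j) ≤
      ENNReal.ofReal ((1 / √alphaZero) ^ Module.finrank ℝ E) • volume := by
  have hα := alphaZero_mem.1
  have hYm : AEMeasurable (fun ω => ∑ j, X j ω • b j) P :=
    Finset.aemeasurable_fun_sum _ fun j _ => (hX_law j).aemeasurable.smul_const _
  set μ := P.map (fun ω => ∑ j, X j ω • b j) with hμ
  have : IsProbabilityMeasure μ := Measure.isProbabilityMeasure_map hYm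
  set φ : E → ℂ := fun ξ =>
    VectorFourier.fourierIntegral Real.fourierChar μ (innerₗ E) (1 : E → ℂ) ξ with hφ
  -- The Fourier kernel is `exp (-2πi⟪x, ξ⟫)`, while `charFun` uses `exp (i⟪x, t⟫)`.
  have hφc : ∀ ξ, φ ξ = charFun μ (-(2 * Real.pi) • ξ) := fun ξ => by
    rw [charFun_eq_fourierIntegral', smul_smul, neg_mul_neg,
      inv_mul_cancel₀ Real.two_pi_pos.ne', one_smul]
  have hφn : ∀ ξ, ‖φ ξ‖ ≤
      ∏ j, scaledKernel alphaZero (inner ℝ (‖b j‖⁻¹ • b j) ξ) ^ (‖b j‖ ^ 2) := fun ξ => by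
    rw [hφc, hμ, norm_charFun_sum_smul hX_indep hX_law]
    refine Finset.prod_le_prod (fun j _ => by positivity) fun j _ => ?_
    refine le_of_eq_of_le ?_ (rpow_neg_half_le_scaledKernel_rpow hα (sq_nonneg ‖b j‖)
      ((Real.le_sqrt (norm_nonneg _) hα.le).1 (hb_norm j)) _)
    congr 2
    rw [real_inner_smul_left, real_inner_smul_right]
    rcases eq_or_ne (b j) 0 with h | h
    · simp [h]
    · have := norm_ne_zero_iff.2 h
      field_simp
  have hlint : ∫⁻ ξ, ENNReal.ofReal ‖φ ξ‖ ≤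
      ENNReal.ofReal ((1 / √alphaZero) ^ Module.finrank ℝ E) := by
    refine (lintegral_mono fun ξ => ENNReal.ofReal_le_ofReal (hφn ξ)).trans ?_
    have := (isDecomposition_normalize hb).lintegral_prod_rpow_le (continuous_scaledKernel hα)
      (integrable_scaledKernel alphaZero_mem) (scaledKernel_pos hα)
    rwa [integral_scaledKernel, F_alphaZero] at this
  have hcont : Continuous φ := by
    refine VectorFourier.fourierIntegral_continuous Real.continuous_fourierChar ?_
      (integrable_const (1 : ℂ))
    simpa using continuous_inner
  have hint : Integrable φ := ⟨hcont.aestronglyMeasurable, by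
    rw [hasFiniteIntegral_iff_norm]; exact hlint.trans_lt ENNReal.ofReal_lt_top⟩
  refine le_smul_volume_of_integral_norm_fourier_le μ hint ?_
  rw [← ENNReal.ofReal_le_ofReal_iff (by positivity)]
  rwa [ofReal_integral_eq_lintegral_ofReal hint.norm
    (Filter.Eventually.of_forall fun _ => norm_nonneg _)]

/-- Over any measurable `s` the derivative integrates to at most `μ s ≤ C * ν s`. -/
lemma rnDeriv_le_of_le_smul {α : Type*} [MeasurableSpace α] {μ ν : Measure α}
    [SigmaFinite ν] {C : ℝ≥0∞} (h : μ ≤ C • ν) : μ.rnDeriv ν ≤ᵐ[ν] fun _ => C := by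
  refine ae_le_of_forall_setLIntegral_le_of_sigmaFinite (Measure.measurable_rnDeriv _ _)
    fun s hs _ => ?_
  rw [setLIntegral_const]
  exact (Measure.setLIntegral_rnDeriv_le s).trans (by simpa using h s)

end Density

end ExponentialSum

/-! ### The density bound in coordinates. -/

theorem corollary4p4 (m n : ℕ) (b : Fin n → EuclideanSpace ℝ (Fin m))
    (hb : ∑ j, Matrix.vecMulVec (b j) (b j) = (1 : Matrix (Fin m) (Fin m) ℝ))
    (hb_norm : ∀ j, ‖b j‖ ≤ √ExponentialSum.alphaZero)
    {Ω : Type*} [MeasurableSpace Ω] (P : Measure Ω) [IsProbabilityMeasure P]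
    (X : Fin n → Ω → ℝ) (hX_indep : iIndepFun X P)
    (hX_law : ∀ j, HasLaw (X j) (expMeasure 1) P) :
    HasPDF (fun ω => ∑ j, X j ω • b j) P volume ∧
      eLpNorm (pdf (fun ω => ∑ j, X j ω • b j) P volume) ∞ volume ≤
        ENNReal.ofReal (ExponentialSum.alphaZero ^ (-(m : ℝ) / 2)) := by
  have hα := ExponentialSum.alphaZero_mem.1
  have hdec : ∀ x, ∑ j, (inner ℝ (b j) x : ℝ) • b j = x := fun x => by
    ext i
    have h := congrFun (congrArg (fun A => A.mulVec x) hb) i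
    simp only [Matrix.sum_mulVec, Matrix.one_mulVec, Finset.sum_apply, Matrix.vecMulVec_mulVec] at h
    rw [← h]
    simp [PiLp.inner_apply, dotProduct, mul_comm]
  have hYm : AEMeasurable (fun ω => ∑ j, X j ω • b j) P :=
    Finset.aemeasurable_fun_sum _ fun j _ => (hX_law j).aemeasurable.smul_const _
  have hle := ExponentialSum.map_sum_smul_le_smul_volume hdec hb_norm hX_indep hX_law
  have hC : (1 / √ExponentialSum.alphaZero) ^ Module.finrank ℝ (EuclideanSpace ℝ (Fin m)) =
      ExponentialSum.alphaZero ^ (-(m : ℝ) / 2) := by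
    rw [finrank_euclideanSpace_fin, Real.sqrt_eq_rpow, one_div, ← Real.rpow_neg hα.le,
      ← Real.rpow_natCast, ← Real.rpow_mul hα.le]
    congr 1
    ring
  rw [hC] at hle
  have : IsProbabilityMeasure (P.map fun ω => ∑ j, X j ω • b j) :=
    Measure.isProbabilityMeasure_map hYm
  -- Domination by a multiple of volume gives both absolute continuity and the bound on the density.
  refine ⟨(hasPDF_iff_of_aemeasurable hYm).2 ⟨inferInstance,
    (Measure.absolutelyContinuous_of_le hle).trans Measure.smul_absolutelyContinuous⟩, ?_⟩
  rw [eLpNorm_exponent_top]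
  exact eLpNormEssSup_le_of_ae_enorm_bound (ExponentialSum.rnDeriv_le_of_le_smul hle)
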